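/- Let $H$ be an infinite-dimensional complex Hilbert space (not necessarily separable), let $B(H)$ be the algebra of bounded linear operators on $H$, and let $V \subseteq B(H)$ be an operator system, i.e. a linear subspace that contains the identity operator and satisfies $A^* \in V$ whenever $A \in V$. For an orthogonal projection $P \in B(H)$ write $PVP = \{PAP : A \in V\}$. Then at least one of the following holds. 1. $V$ has an infinite quantum clique: there is an orthogonal projection $P \in B(H)$ of infinite rank such that $PVP$ is dense in $P B(H) P$ with respect to the weak operator topology. 2. $V$ has an infinite quantum almost anticlique: there is an orthogonal projection $P \in B(H)$ of infinite rank such that $PVP$ is finite-dimensional and every operator in $PVP$ can be written as $cP + K$ with $c \in \mathbb{C}$ and $K \in B(H)$ compact. -/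

import Mathlib

/-- An operator system on a complex Hilbert space `H`: a linear subspace of `B(H)` that contains
the identity operator and is closed under taking adjoints. -/
structure IsOperatorSystem {H : Type*} [NormedAddCommGroup H] [InnerProductSpace ℂ H]
    [CompleteSpace H] (V : Submodule ℂ (H →L[ℂ] H)) : Prop where
  one_mem : (1 : H →L[ℂ] H) ∈ V
  adjoint_mem : ∀ A ∈ V, ContinuousLinearMap.adjoint A ∈ V

/-- The compression `P V P = {P A P : A ∈ V}` of a subspace `V ⊆ B(H)`, again a subspace. -/
def compression {H : Type*} [NormedAddCommGroup H] [InnerProductSpace ℂ H]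
    (P : H →L[ℂ] H) (V : Submodule ℂ (H →L[ℂ] H)) : Submodule ℂ (H →L[ℂ] H) :=
  V.map (LinearMap.mulLeftRight ℂ (P, P))

/-- The compression is the set of all operators `P A P` with `A ∈ V`. -/
theorem mem_compression {H : Type*} [NormedAddCommGroup H] [InnerProductSpace ℂ H]
    (P : H →L[ℂ] H) (V : Submodule ℂ (H →L[ℂ] H)) (B : H →L[ℂ] H) :
    B ∈ compression P V ↔ ∃ A ∈ V, P * A * P = B := by
  simp [compression, LinearMap.mulLeftRight_apply]

/-- An orthogonal projection (self-adjoint idempotent) of infinite rank. -/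
structure IsInfiniteRankProjection {H : Type*} [NormedAddCommGroup H] [InnerProductSpace ℂ H]
    [CompleteSpace H] (P : H →L[ℂ] H) : Prop where
  isStarProjection : IsStarProjection P
  infinite_rank : ¬ FiniteDimensional ℂ (LinearMap.range (P : H →ₗ[ℂ] H))

/-- `P` is an infinite quantum clique of `V`: an infinite rank orthogonal projection such that
`P V P` is dense in `P B(H) P` for the weak operator topology. (`ContinuousLinearMapWOT.ofCLM`
is the identity map from `B(H)` to `B(H)` with the weak operator topology.) -/
structure IsInfiniteQuantumClique {H : Type*} [NormedAddCommGroup H] [InnerProductSpace ℂ H]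
    [CompleteSpace H] (V : Submodule ℂ (H →L[ℂ] H)) (P : H →L[ℂ] H) : Prop where
  isInfiniteRankProjection : IsInfiniteRankProjection P
  weakly_dense :
    (ContinuousLinearMapWOT.ofCLM '' (compression P ⊤ : Set (H →L[ℂ] H)) : Set (H →WOT[ℂ] H)) ⊆
      closure (ContinuousLinearMapWOT.ofCLM '' (compression P V : Set (H →L[ℂ] H)))

/-- `P` is an infinite quantum almost anticlique of `V`: an infinite rank orthogonal projection
such that `P V P` is finite dimensional and each of its elements is a scalar multiple of `P` plus
a compact operator. -/
structure IsInfiniteQuantumAlmostAnticlique {H : Type*} [NormedAddCommGroup H]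
    [InnerProductSpace ℂ H] [CompleteSpace H] (V : Submodule ℂ (H →L[ℂ] H))
    (P : H →L[ℂ] H) : Prop where
  isInfiniteRankProjection : IsInfiniteRankProjection P
  finiteDimensional : FiniteDimensional ℂ (compression P V)
  scalar_add_compact : ∀ B ∈ compression P V,
    ∃ (c : ℂ) (K : H →L[ℂ] H), IsCompactOperator K ∧ B = c • P + K

/-!
The argument is a dichotomy. If some compression `P V P` of infinite rank is finite-dimensional,
an orthonormal sequence in the range of `P` can be chosen that diagonalizes all of `P V P` at once
(each new vector avoids finitely many earlier images) and along which all diagonals converge. On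
the closed span of such a sequence every element of `V` compresses to a scalar plus a diagonal
operator with null diagonal, hence a scalar plus a compact operator: an almost anticlique
(`exists_isInfiniteQuantumAlmostAnticlique`).

Otherwise finitely many linear conditions on `A ∈ V` never force `A` to vanish on a subspace of
finite codimension (`exists_mem_ker_inner_ne_zero`). This yields an orthonormal sequence `x m` and
operators `A m ∈ V` whose matrices vanish before the index `m`, have entry `1` at `(m, m)` and are
diagonal except for an arrow in the `m`-th row and column (`exists_isArrowSystem`). The part of
these arrows at the first `M` indices lives in a space of finite dimension, so a linear relation
between arrows allows one to cancel them by passing to block combinations of the `x m` and of the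
`A m` (`IsArrowSystem.exists_block_ne_zero`). Combining consecutive operators to make the diagonals
null, and then thinning out the sequence, gives operators of `V` that are as close as desired to
the diagonal matrix units `|x k⟩⟨x k|` on the closed span of `x`
(`IsDiagonalSystem.exists_approx_matrixUnit`).

So `V` looks like the diagonal algebra there, and the clique comes from dilating a frame. Let `K` be
the closed span of the `x (2 i)` and let the range of `P` be the graph over `K` of
`u ↦ ∑ 2⁻ʲ ⟪w j, u⟫ x (2 j + 1)`, where the `w j ∈ K` run infinitely often through a set of dense
directions. The compression of `|x (2 j + 1)⟩⟨x (2 j + 1)|` to this graph is `4⁻ʲ |w j⟩⟨w j|` in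
terms of `K`. A finite-rank functional that annihilates `P V P` is therefore small, and in the limit
zero, on all `|w⟩⟨w|`, so it is zero by polarization. By duality in finite dimension this is density
for the weak operator topology (`mem_closure_ofCLM_image`,
`exists_isInfiniteQuantumClique_of_approx`).
-/

open Filter Topology
open scoped InnerProductSpace ComplexConjugate

section

variable {H : Type*} [NormedAddCommGroup H] [InnerProductSpace ℂ H]

/-! ### Choosing sequences -/

/-- Dependent choice in which each term may depend on the whole set of its predecessors. -/
theorem exists_seq_of_forall_finset {α : Type*} [DecidableEq α] (R : Finset α → α → Prop)
    (h : ∀ s, ∃ y, R s y) : ∃ f : ℕ → α, ∀ n, R ((Finset.range n).image f) (f n) := by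
  choose g hg using h
  -- `F n` is the set of the first `n` terms.
  let F : ℕ → Finset α := fun n => n.rec ∅ fun _ s => insert (g s) s
  refine ⟨fun n => g (F n), fun n => ?_⟩
  have hF : ∀ n, (Finset.range n).image (fun n => g (F n)) = F n := by
    intro n
    induction n with
    | zero => rfl
    | succ k ih => rw [Finset.range_add_one, Finset.image_insert, ih]
  rw [hF]
  exact hg _

/-- In a finite-dimensional space some term of any sequence depends on its predecessors. -/
theorem exists_eq_sum_range_smul {E : Type*} [AddCommGroup E] [Module ℂ E]
    [FiniteDimensional ℂ E] (c : ℕ → E) :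
    ∃ (N : ℕ) (r : ℕ → ℂ), c N = ∑ k ∈ Finset.range N, r k • c k := by
  have hdep : ¬ LinearIndependent ℂ c := fun h => by
    have := h.finite
    exact not_finite ℕ
  rw [linearIndependent_iff] at hdep
  push Not at hdep
  obtain ⟨l, hl, hl0⟩ := hdep
  have hne : l.support.Nonempty := Finsupp.support_nonempty_iff.2 hl0
  set N := l.support.max' hne with hN
  have hlN : l N ≠ 0 := Finsupp.mem_support_iff.1 (l.support.max'_mem hne)
  have hsub : l.support ⊆ Finset.range (N + 1) := fun i hi =>
    Finset.mem_range.2 (Nat.lt_succ_of_le (l.support.le_max' i hi))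
  rw [Finsupp.linearCombination_apply, Finsupp.sum_of_support_subset _ hsub _ (by simp),
    Finset.sum_range_succ] at hl
  refine ⟨N, fun k => -((l N)⁻¹ * l k), ?_⟩
  have h1 : l N • c N = -∑ k ∈ Finset.range N, l k • c k := by
    rw [eq_neg_iff_add_eq_zero, add_comm]; exact hl
  calc c N = (l N)⁻¹ • (l N • c N) := by rw [smul_smul, inv_mul_cancel₀ hlN, one_smul]
    _ = _ := by
      rw [h1, smul_neg, Finset.smul_sum, ← Finset.sum_neg_distrib]
      simp only [neg_smul, smul_smul]

/-! ### Operators that are diagonal on an orthonormal sequence -/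

/-- A bound for the diagonal entries bounds the form on the whole closed span. -/
theorem norm_inner_le_of_diagonal {y : ℕ → H} (hy : Orthonormal ℂ y) (A : H →L[ℂ] H) {ε : ℝ}
    (hε : 0 ≤ ε) (hoff : ∀ i j, i ≠ j → ⟪y i, A (y j)⟫_ℂ = 0) (hdiag : ∀ i, ‖⟪y i, A (y i)⟫_ℂ‖ ≤ ε)
    {u v : H} (hu : u ∈ (Submodule.span ℂ (Set.range y)).topologicalClosure)
    (hv : v ∈ (Submodule.span ℂ (Set.range y)).topologicalClosure) :
    ‖⟪v, A u⟫_ℂ‖ ≤ ε * (‖v‖ * ‖u‖) := by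
  have hspan : ∀ u ∈ Submodule.span ℂ (Set.range y), ∀ v ∈ Submodule.span ℂ (Set.range y),
      ‖⟪v, A u⟫_ℂ‖ ≤ ε * (‖v‖ * ‖u‖) := by
    intro u hu v hv
    obtain ⟨a, rfl⟩ := Finsupp.mem_span_range_iff_exists_finsupp.1 hu
    obtain ⟨b, rfl⟩ := Finsupp.mem_span_range_iff_exists_finsupp.1 hv
    set s := a.support ∪ b.support
    rw [Finsupp.sum_of_support_subset a (s := s) Finset.subset_union_left _ (by simp),
      Finsupp.sum_of_support_subset b (s := s) Finset.subset_union_right _ (by simp)]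
    have hnorm : ∀ c : ℕ → ℂ, ‖∑ i ∈ s, c i • y i‖ = √(∑ i ∈ s, ‖c i‖ ^ 2) := by
      intro c
      rw [eq_comm, Real.sqrt_eq_iff_eq_sq (by positivity) (norm_nonneg _),
        @norm_sq_eq_re_inner ℂ, hy.inner_sum]
      simp only [Complex.conj_mul']
      norm_cast
    rw [hnorm, hnorm]
    calc ‖⟪∑ i ∈ s, b i • y i, A (∑ i ∈ s, a i • y i)⟫_ℂ‖
        = ‖∑ i ∈ s, conj (b i) * (a i * ⟪y i, A (y i)⟫_ℂ)‖ := by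
          congr 1
          rw [sum_inner]
          refine Finset.sum_congr rfl fun i hi => ?_
          rw [map_sum, inner_smul_left, inner_sum, Finset.sum_eq_single i]
          · rw [map_smul, inner_smul_right]
          · intro j _ hj
            rw [map_smul, inner_smul_right, hoff i j hj.symm, mul_zero]
          · exact fun h => absurd hi h
      _ ≤ ∑ i ∈ s, ε * (‖b i‖ * ‖a i‖) := by
          refine (norm_sum_le _ _).trans (Finset.sum_le_sum fun i _ => ?_)
          rw [norm_mul, norm_mul, RCLike.norm_conj]
          calc ‖b i‖ * (‖a i‖ * ‖⟪y i, A (y i)⟫_ℂ‖) ≤ ‖b i‖ * (‖a i‖ * ε) := by gcongr; exact hdiag i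
            _ = _ := by ring
      _ ≤ _ := by
          rw [← Finset.mul_sum]
          gcongr
          exact Real.sum_mul_le_sqrt_mul_sqrt _ _ _
  have hclosed : IsClosed {p : H × H | ‖⟪p.2, A p.1⟫_ℂ‖ ≤ ε * (‖p.2‖ * ‖p.1‖)} :=
    isClosed_le (by fun_prop) (by fun_prop)
  have hmem : (u, v) ∈ closure ((Submodule.span ℂ (Set.range y) : Set H) ×ˢ
      (Submodule.span ℂ (Set.range y) : Set H)) := by
    rw [closure_prod_eq]
    exact ⟨hu, hv⟩
  exact closure_minimal (fun p hp => hspan p.1 hp.1 p.2 hp.2) hclosed hmem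

/-! ### Arrow systems -/

/-- An orthonormal sequence `x` with operators `A m` such that the matrix of `A m` with respect to
`x` vanishes at all indices below `m`, has entry `1` at `(m, m)`, and has no off-diagonal entries
except in the `m`-th row and column to the left of and above the diagonal. -/
structure IsArrowSystem (x : ℕ → H) (A : ℕ → H →L[ℂ] H) : Prop where
  orthonormal : Orthonormal ℂ x
  offDiag : ∀ m i j, i ≠ j → max i j ≠ m → ⟪x i, A m (x j)⟫_ℂ = 0
  diag_lt : ∀ m i, i < m → ⟪x i, A m (x i)⟫_ℂ = 0
  diag_self : ∀ m, ⟪x m, A m (x m)⟫_ℂ = 1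

theorem IsArrowSystem.inner_eq_zero_of_lt {x : ℕ → H} {A : ℕ → H →L[ℂ] H} (h : IsArrowSystem x A)
    {m i j : ℕ} (hi : i < m) (hj : j < m) : ⟪x i, A m (x j)⟫_ℂ = 0 := by
  rcases eq_or_ne i j with rfl | hij
  · exact h.diag_lt m i hi
  · exact h.offDiag m i j hij (by omega)

theorem finiteDimensional_range_of_ker_le {E F G : Type*} [AddCommGroup E] [Module ℂ E]
    [AddCommGroup F] [Module ℂ F] [FiniteDimensional ℂ F] [AddCommGroup G] [Module ℂ G]
    (f : E →ₗ[ℂ] F) (g : E →ₗ[ℂ] G) (h : LinearMap.ker f ≤ LinearMap.ker g) :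
    FiniteDimensional ℂ (LinearMap.range g) := by
  have : FiniteDimensional ℂ (E ⧸ LinearMap.ker f) :=
    f.quotKerEquivRange.symm.finiteDimensional
  rw [← Submodule.range_liftQ (LinearMap.ker f) g h]
  infer_instance

theorem compression_eq_range (P : H →L[ℂ] H) (V : Submodule ℂ (H →L[ℂ] H)) :
    compression P V = LinearMap.range ((LinearMap.mulLeftRight ℂ (P, P)) ∘ₗ V.subtype) := by
  rw [LinearMap.range_comp, Submodule.range_subtype]
  rfl

theorem not_finiteDimensional_orthogonal (hH : ¬ FiniteDimensional ℂ H) (G : Submodule ℂ H)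
    [FiniteDimensional ℂ G] : ¬ FiniteDimensional ℂ Gᗮ := by
  intro h
  apply hH
  have h1 : FiniteDimensional ℂ (G ⊔ Gᗮ : Submodule ℂ H) := inferInstance
  rw [Submodule.sup_orthogonal_of_hasOrthogonalProjection] at h1
  exact Submodule.topEquiv.finiteDimensional

theorem starProjection_mul_mul_eq_zero {M : Submodule ℂ H} [M.HasOrthogonalProjection]
    {A : H →L[ℂ] H} (h : ∀ x ∈ M, ⟪x, A x⟫_ℂ = 0) :
    M.starProjection * A * M.starProjection = 0 := by
  rw [← ContinuousLinearMap.coe_inj, ContinuousLinearMap.toLinearMap_zero,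
    ← inner_map_self_eq_zero]
  intro x
  change ⟪M.starProjection (A (M.starProjection x)), x⟫_ℂ = 0
  rw [Submodule.inner_starProjection_left_eq_right, ← inner_conj_symm,
    h _ (Submodule.starProjection_apply_mem _ x), map_zero]

section

variable [CompleteSpace H]

theorem isInfiniteRankProjection_starProjection {M : Submodule ℂ H} [M.HasOrthogonalProjection]
    (hM : ¬ FiniteDimensional ℂ M) : IsInfiniteRankProjection M.starProjection where
  isStarProjection := isStarProjection_starProjection
  infinite_rank := by
    rwa [show LinearMap.range (M.starProjection : H →ₗ[ℂ] H) = M from M.range_starProjection]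

/-- A finite-codimensional subspace of `V` does not vanish on a finite-codimensional subspace of
`H`, unless some compression of `V` of infinite rank is finite-dimensional. -/
theorem exists_mem_ker_inner_ne_zero (hH : ¬ FiniteDimensional ℂ H)
    {V : Submodule ℂ (H →L[ℂ] H)}
    (hV : ∀ P, IsInfiniteRankProjection P → ¬ FiniteDimensional ℂ (compression P V))
    (G : Submodule ℂ H) [FiniteDimensional ℂ G] {F : Type*} [AddCommGroup F] [Module ℂ F]
    [FiniteDimensional ℂ F] (f : V →ₗ[ℂ] F) :
    ∃ A : V, f A = 0 ∧ ∃ x ∈ Gᗮ, ⟪x, (A : H →L[ℂ] H) x⟫_ℂ ≠ 0 := by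
  by_contra! hcon
  apply hV _ (isInfiniteRankProjection_starProjection (not_finiteDimensional_orthogonal hH G))
  rw [compression_eq_range]
  refine finiteDimensional_range_of_ker_le f _ fun A hA => ?_
  exact starProjection_mul_mul_eq_zero (hcon A hA)

/-- The inductive step for arrow systems. A pair consists of a vector and its operator, and `s` is
the set of the pairs already chosen. -/
theorem exists_next_arrow (hH : ¬ FiniteDimensional ℂ H) {V : Submodule ℂ (H →L[ℂ] H)}
    (hV : ∀ P, IsInfiniteRankProjection P → ¬ FiniteDimensional ℂ (compression P V))
    (s : Finset (H × (H →L[ℂ] H))) :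
    ∃ p : H × (H →L[ℂ] H), p.2 ∈ V ∧ ‖p.1‖ = 1 ∧ ⟪p.1, p.2 p.1⟫_ℂ = 1 ∧
      (∀ q ∈ s, ∀ q' ∈ s, ⟪q.1, p.2 q'.1⟫_ℂ = 0) ∧ (∀ q ∈ s, ⟪q.1, p.1⟫_ℂ = 0) ∧
      ∀ q ∈ s, ∀ q' ∈ s, ⟪p.1, q.2 q'.1⟫_ℂ = 0 ∧ ⟪q'.1, q.2 p.1⟫_ℂ = 0 := by
  let G : Submodule ℂ H := Submodule.span ℂ (((fun q : H × (H →L[ℂ] H) => q.1) '' s) ∪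
    ((fun q : (H × (H →L[ℂ] H)) × (H × (H →L[ℂ] H)) => q.1.2 q.2.1) '' (s ×ˢ s : Set _)) ∪
    ((fun q : (H × (H →L[ℂ] H)) × (H × (H →L[ℂ] H)) => q.1.2.adjoint q.2.1) '' (s ×ˢ s : Set _)))
  have hsfin : (s : Set (H × (H →L[ℂ] H))).Finite := s.finite_toSet
  have : FiniteDimensional ℂ G := FiniteDimensional.span_of_finite ℂ
    (((hsfin.image _).union ((hsfin.prod hsfin).image _)).union ((hsfin.prod hsfin).image _))
  let f : V →ₗ[ℂ] (s × s → ℂ) := LinearMap.pi fun p =>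
    (innerSL ℂ p.1.1.1).toLinearMap ∘ₗ (ContinuousLinearMap.apply ℂ H p.2.1.1).toLinearMap ∘ₗ
      V.subtype
  obtain ⟨A, hA, x, hx, hAx⟩ := exists_mem_ker_inner_ne_zero hH hV G f
  have hx0 : ‖x‖ ≠ 0 := by
    intro h
    rw [norm_eq_zero] at h
    simp [h] at hAx
  have hG : ∀ z ∈ G, ⟪z, x⟫_ℂ = 0 := (Submodule.mem_orthogonal _ _).1 hx
  set c := ⟪x, (A : H →L[ℂ] H) x⟫_ℂ
  refine ⟨(((‖x‖⁻¹ : ℝ) : ℂ) • x, ((‖x‖ ^ 2 : ℝ) * c⁻¹ : ℂ) • A.1), V.smul_mem _ A.2, ?_, ?_, ?_,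
    ?_, ?_⟩
  · simp [norm_smul, hx0]
  · have : (‖x‖ : ℂ) ≠ 0 := by exact_mod_cast hx0
    simp only [map_smul, inner_smul_left, inner_smul_right, smul_apply,
      Complex.conj_ofReal]
    change _ * (_ * (_ * c)) = 1
    push_cast
    field_simp
  · intro q hq q' hq'
    have h : ⟪q.1, A.1 q'.1⟫_ℂ = 0 := congr_fun hA (⟨q, hq⟩, ⟨q', hq'⟩)
    simp [h]
  · intro q hq
    have h : ⟪q.1, x⟫_ℂ = 0 := hG _ (Submodule.subset_span (Or.inl (Or.inl ⟨q, hq, rfl⟩)))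
    simp [h]
  · intro q hq q' hq'
    have h1 : ⟪q.2 q'.1, x⟫_ℂ = 0 :=
      hG _ (Submodule.subset_span (Or.inl (Or.inr ⟨(q, q'), ⟨hq, hq'⟩, rfl⟩)))
    have h2 : ⟪q.2.adjoint q'.1, x⟫_ℂ = 0 :=
      hG _ (Submodule.subset_span (Or.inr ⟨(q, q'), ⟨hq, hq'⟩, rfl⟩))
    rw [ContinuousLinearMap.adjoint_inner_left] at h2
    refine ⟨?_, ?_⟩
    · rw [← inner_conj_symm]
      simp [inner_smul_right, h1]
    · simp [h2]

theorem exists_isArrowSystem (hH : ¬ FiniteDimensional ℂ H) {V : Submodule ℂ (H →L[ℂ] H)}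
    (hV : ∀ P, IsInfiniteRankProjection P → ¬ FiniteDimensional ℂ (compression P V)) :
    ∃ (x : ℕ → H) (A : ℕ → H →L[ℂ] H), IsArrowSystem x A ∧ ∀ m, A m ∈ V := by
  classical
  obtain ⟨p, hp⟩ := exists_seq_of_forall_finset _ (exists_next_arrow hH hV)
  have hmem : ∀ {i n}, i < n → p i ∈ (Finset.range n).image p := fun h =>
    Finset.mem_image_of_mem _ (Finset.mem_range.2 h)
  choose hpV hnorm hdiag hlt horth hgt using hp
  refine ⟨fun n => (p n).1, fun n => (p n).2, ⟨⟨hnorm, ?_⟩, ?_, ?_, hdiag⟩, hpV⟩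
  · intro i j hij
    rcases hij.lt_or_gt with h | h
    · exact horth j _ (hmem h)
    · rw [← inner_conj_symm, horth i _ (hmem h), map_zero]
  · intro m i j hij hm
    rcases lt_or_gt_of_ne hm with h | h
    · exact hlt m _ (hmem (by omega)) _ (hmem (by omega))
    · rcases hij.lt_or_gt with h' | h'
      · exact (hgt j (p m) (hmem (by omega)) (p i) (hmem h')).2
      · exact (hgt i (p m) (hmem (by omega)) (p j) (hmem h')).1
  · exact fun m i h => hlt m _ (hmem h) _ (hmem h)

end

/-! ### From arrow systems to diagonal systems -/

/-- An orthonormal sequence `y` with operators `B n` whose matrices with respect to `y` are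
diagonal, vanish at all indices below `n`, and have entry `1` at `(n, n)`. -/
structure IsDiagonalSystem (y : ℕ → H) (B : ℕ → H →L[ℂ] H) : Prop where
  orthonormal : Orthonormal ℂ y
  offDiag : ∀ n i j, i ≠ j → ⟪y i, B n (y j)⟫_ℂ = 0
  diag_lt : ∀ n i, i < n → ⟪y i, B n (y i)⟫_ℂ = 0
  diag_self : ∀ n, ⟪y n, B n (y n)⟫_ℂ = 1

theorem inner_apply_eq_zero_of_mem_span {x : ℕ → H} {A : ℕ → H →L[ℂ] H} {S T U : Set ℕ}
    (h : ∀ i ∈ S, ∀ k ∈ T, ∀ j ∈ U, ⟪x i, A k (x j)⟫_ℂ = 0) {y z : H} {B : H →L[ℂ] H}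
    (hy : y ∈ Submodule.span ℂ (x '' S)) (hB : B ∈ Submodule.span ℂ (A '' T))
    (hz : z ∈ Submodule.span ℂ (x '' U)) : ⟪y, B z⟫_ℂ = 0 := by
  induction hy using Submodule.span_induction with
  | zero => simp
  | add _ _ _ _ h1 h2 => rw [inner_add_left, h1, h2, add_zero]
  | smul _ _ _ h1 => rw [inner_smul_left, h1, mul_zero]
  | mem y hy =>
    obtain ⟨i, hi, rfl⟩ := hy
    induction hB using Submodule.span_induction with
    | zero => simp
    | add _ _ _ _ h1 h2 => rw [add_apply, inner_add_right, h1, h2, add_zero]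
    | smul _ _ _ h1 => rw [smul_apply, inner_smul_right, h1, mul_zero]
    | mem B hB =>
      obtain ⟨k, hk, rfl⟩ := hB
      induction hz using Submodule.span_induction with
      | zero => simp
      | add _ _ _ _ h1 h2 => rw [map_add, inner_add_right, h1, h2, add_zero]
      | smul _ _ _ h1 => rw [map_smul, inner_smul_right, h1, mul_zero]
      | mem z hz =>
        obtain ⟨j, hj, rfl⟩ := hz
        exact h i hi k hk j hj

/-- The entries in the arrows of `A m`, for `m ≥ M`, at the first `M` indices lie in a
finite-dimensional space, so some arrow is a combination of the preceding ones. This relation makes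
the arrows of suitable combinations `y` and `B` cancel. -/
theorem IsArrowSystem.exists_block_ne_zero {x : ℕ → H} {A : ℕ → H →L[ℂ] H}
    (h : IsArrowSystem x A) (M : ℕ) :
    ∃ M' > M, ∃ y ∈ Submodule.span ℂ (x '' Set.Ico M M'),
      ∃ B ∈ Submodule.span ℂ (A '' Set.Ico M M'),
      (∀ i < M, ⟪x i, B y⟫_ℂ = 0 ∧ ⟪y, B (x i)⟫_ℂ = 0) ∧ ⟪y, B y⟫_ℂ ≠ 0 := by
  let c : ℕ → (Fin M → ℂ) × (Fin M → ℂ) := fun k =>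
    (fun i => ⟪x (M + k), A (M + k) (x i)⟫_ℂ, fun i => ⟪A (M + k) (x (M + k)), x i⟫_ℂ)
  obtain ⟨N, r, hr⟩ := exists_eq_sum_range_smul c
  have hr1 : ∀ i < M, ⟪x (M + N), A (M + N) (x i)⟫_ℂ =
      ∑ k ∈ Finset.range N, r k * ⟪x (M + k), A (M + k) (x i)⟫_ℂ := fun i hi => by
    simpa [c, Prod.fst_sum] using congr_fun (congr_arg Prod.fst hr) ⟨i, hi⟩
  have hr2 : ∀ i < M, ⟪A (M + N) (x (M + N)), x i⟫_ℂ =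
      ∑ k ∈ Finset.range N, r k * ⟪A (M + k) (x (M + k)), x i⟫_ℂ := fun i hi => by
    simpa [c, Prod.snd_sum] using congr_fun (congr_arg Prod.snd hr) ⟨i, hi⟩
  set y₀ : H := ∑ k ∈ Finset.range N, conj (r k) • x (M + k) with hy₀
  set B₀ : H →L[ℂ] H := ∑ k ∈ Finset.range N, A (M + k) with hB₀
  have hy₀mem : y₀ ∈ Submodule.span ℂ (x '' Set.Ico M (M + N)) :=
    Submodule.sum_mem _ fun k hk => Submodule.smul_mem _ _ <| Submodule.subset_span
      ⟨M + k, ⟨by omega, by have := Finset.mem_range.1 hk; omega⟩, rfl⟩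
  have hB₀mem : B₀ ∈ Submodule.span ℂ (A '' Set.Ico M (M + N)) :=
    Submodule.sum_mem _ fun k hk => Submodule.subset_span
      ⟨M + k, ⟨by omega, by have := Finset.mem_range.1 hk; omega⟩, rfl⟩
  have hxself : ∀ k, x k ∈ Submodule.span ℂ (x '' {k}) := fun k =>
    Submodule.subset_span ⟨k, rfl, rfl⟩
  have hAself : ∀ k, A k ∈ Submodule.span ℂ (A '' {k}) := fun k =>
    Submodule.subset_span ⟨k, rfl, rfl⟩
  -- With coefficients `-τ` at the last vector and `τ` at the last operator, where `τ = ±1`, the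
  -- product is `-1` and the relation makes the arrows cancel for both signs.
  have hcancel : ∀ τ : ℝ, τ * τ = 1 → ∀ i < M,
      ⟪x i, (B₀ + (τ : ℂ) • A (M + N)) (y₀ - (τ : ℂ) • x (M + N))⟫_ℂ = 0 ∧
      ⟪y₀ - (τ : ℂ) • x (M + N), (B₀ + (τ : ℂ) • A (M + N)) (x i)⟫_ℂ = 0 := by
    intro τ hτ i hi
    have hτ' : (τ : ℂ) * τ = 1 := by exact_mod_cast hτ
    have hi' : x i ∈ Submodule.span ℂ (x '' {i}) := hxself i
    have e1 : ⟪x i, A (M + N) y₀⟫_ℂ = 0 := inner_apply_eq_zero_of_mem_span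
      (by rintro _ rfl _ rfl j ⟨_, hj⟩; exact h.inner_eq_zero_of_lt (by omega) hj)
      hi' (hAself _) hy₀mem
    have e2 : ⟪y₀, A (M + N) (x i)⟫_ℂ = 0 := inner_apply_eq_zero_of_mem_span
      (by rintro j ⟨_, hj⟩ _ rfl _ rfl; exact h.inner_eq_zero_of_lt hj (by omega))
      hy₀mem (hAself _) hi'
    have e3 : ⟪x i, B₀ (x (M + N))⟫_ℂ = 0 := inner_apply_eq_zero_of_mem_span
      (by rintro _ rfl k ⟨_, hk⟩ _ rfl; exact h.offDiag _ _ _ (by omega) (by omega))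
      hi' hB₀mem (hxself _)
    have e4 : ⟪x (M + N), B₀ (x i)⟫_ℂ = 0 := inner_apply_eq_zero_of_mem_span
      (by rintro _ rfl k ⟨_, hk⟩ _ rfl; exact h.offDiag _ _ _ (by omega) (by omega))
      (hxself _) hB₀mem hi'
    have e5 : ⟪y₀, B₀ (x i)⟫_ℂ = ⟪x (M + N), A (M + N) (x i)⟫_ℂ := by
      rw [hr1 i hi, hy₀, sum_inner]
      refine Finset.sum_congr rfl fun k hk => ?_
      rw [inner_smul_left, Complex.conj_conj, hB₀, sum_apply, inner_sum,
        Finset.sum_eq_single_of_mem k hk]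
      intro l _ hl
      exact h.offDiag _ _ _ (by omega) (by omega)
    have e6 : ⟪x i, B₀ y₀⟫_ℂ = ⟪x i, A (M + N) (x (M + N))⟫_ℂ := by
      rw [← inner_conj_symm _ (A (M + N) (x (M + N))), hr2 i hi, hy₀, map_sum, map_sum, inner_sum]
      refine Finset.sum_congr rfl fun k hk => ?_
      rw [map_smul, inner_smul_right, map_mul, inner_conj_symm, hB₀,
        sum_apply, inner_sum, Finset.sum_eq_single_of_mem k hk]
      intro l _ hl
      exact h.offDiag _ _ _ (by omega) (by omega)
    simp only [add_apply, smul_apply, map_sub, map_smul, inner_add_right, inner_sub_left,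
      inner_sub_right, inner_smul_left, inner_smul_right, Complex.conj_ofReal, e1, e2, e3, e4, e5,
      e6]
    constructor <;> linear_combination -(_ * hτ')
  -- The values of the quadratic form for the two signs differ by `2`, so one of them is nonzero.
  have hval : ∀ τ : ℝ, τ * τ = 1 →
      ⟪y₀ - (τ : ℂ) • x (M + N), (B₀ + (τ : ℂ) • A (M + N)) (y₀ - (τ : ℂ) • x (M + N))⟫_ℂ =
        ⟪y₀, B₀ y₀⟫_ℂ - ⟪y₀, A (M + N) (x (M + N))⟫_ℂ - ⟪x (M + N), A (M + N) y₀⟫_ℂ +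
          ⟪x (M + N), B₀ (x (M + N))⟫_ℂ + τ := by
    intro τ hτ
    have hτ' : (τ : ℂ) * τ = 1 := by exact_mod_cast hτ
    have e1 : ⟪y₀, A (M + N) y₀⟫_ℂ = 0 := inner_apply_eq_zero_of_mem_span
      (by rintro i ⟨_, hi⟩ _ rfl j ⟨_, hj⟩; exact h.inner_eq_zero_of_lt hi hj)
      hy₀mem (hAself _) hy₀mem
    have e2 : ⟪y₀, B₀ (x (M + N))⟫_ℂ = 0 := inner_apply_eq_zero_of_mem_span
      (by rintro i ⟨_, hi⟩ k ⟨_, hk⟩ _ rfl; exact h.offDiag _ _ _ (by omega) (by omega))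
      hy₀mem hB₀mem (hxself _)
    have e3 : ⟪x (M + N), B₀ y₀⟫_ℂ = 0 := inner_apply_eq_zero_of_mem_span
      (by rintro _ rfl k ⟨_, hk⟩ i ⟨_, hi⟩; exact h.offDiag _ _ _ (by omega) (by omega))
      (hxself _) hB₀mem hy₀mem
    simp only [add_apply, smul_apply, map_sub, map_smul, inner_add_right, inner_sub_left,
      inner_sub_right, inner_smul_left, inner_smul_right, Complex.conj_ofReal, e1, e2, e3,
      h.diag_self]
    linear_combination (⟪x (M + N), B₀ (x (M + N))⟫_ℂ + τ - ⟪y₀, A (M + N) (x (M + N))⟫_ℂ -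
      ⟪x (M + N), A (M + N) y₀⟫_ℂ) * hτ'
  have hmono : Set.Ico M (M + N) ⊆ Set.Ico M (M + N + 1) := Set.Ico_subset_Ico_right (by omega)
  have hmem : ∀ τ : ℝ, y₀ - (τ : ℂ) • x (M + N) ∈
      Submodule.span ℂ (x '' Set.Ico M (M + N + 1)) := fun τ =>
    Submodule.sub_mem _ (Submodule.span_mono (Set.image_mono hmono) hy₀mem)
      (Submodule.smul_mem _ _ (Submodule.subset_span ⟨M + N, ⟨by omega, by omega⟩, rfl⟩))
  have hmem' : ∀ τ : ℝ, B₀ + (τ : ℂ) • A (M + N) ∈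
      Submodule.span ℂ (A '' Set.Ico M (M + N + 1)) := fun τ =>
    Submodule.add_mem _ (Submodule.span_mono (Set.image_mono hmono) hB₀mem)
      (Submodule.smul_mem _ _ (Submodule.subset_span ⟨M + N, ⟨by omega, by omega⟩, rfl⟩))
  refine ⟨M + N + 1, by omega, ?_⟩
  by_contra! hcon
  have h1 := hcon _ (hmem 1) _ (hmem' 1) (hcancel 1 (by norm_num))
  have h2 := hcon _ (hmem (-1)) _ (hmem' (-1)) (hcancel (-1) (by norm_num))
  rw [hval 1 (by norm_num)] at h1
  rw [hval (-1) (by norm_num), ← h1] at h2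
  push_cast at h2
  exact absurd (add_left_cancel h2) (by norm_num)

theorem IsArrowSystem.exists_block {x : ℕ → H} {A : ℕ → H →L[ℂ] H}
    (h : IsArrowSystem x A) (M : ℕ) :
    ∃ M' > M, ∃ y ∈ Submodule.span ℂ (x '' Set.Ico M M'),
      ∃ B ∈ Submodule.span ℂ (A '' Set.Ico M M'),
      (∀ i < M, ⟪x i, B y⟫_ℂ = 0 ∧ ⟪y, B (x i)⟫_ℂ = 0) ∧ ‖y‖ = 1 ∧ ⟪y, B y⟫_ℂ = 1 := by
  obtain ⟨M', hM', y, hy, B, hB, hcross, hne⟩ := h.exists_block_ne_zero M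
  have hy0 : ‖y‖ ≠ 0 := fun h0 => by simp [norm_eq_zero.1 h0] at hne
  have hy0' : (‖y‖ : ℂ) ≠ 0 := by exact_mod_cast hy0
  refine ⟨M', hM', ((‖y‖⁻¹ : ℝ) : ℂ) • y, Submodule.smul_mem _ _ hy,
    ((‖y‖ : ℂ) ^ 2 * (⟪y, B y⟫_ℂ)⁻¹) • B, Submodule.smul_mem _ _ hB, fun i hi => ?_, ?_, ?_⟩
  · simp only [smul_apply, map_smul, inner_smul_left, inner_smul_right, hcross i hi, mul_zero,
      and_self]
  · simp [norm_smul, hy0]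
  · simp only [smul_apply, map_smul, inner_smul_left, inner_smul_right, Complex.conj_ofReal]
    push_cast
    field_simp

/-- Consecutive blocks are joined into a diagonal system: inside a block the arrows cancel against
all earlier vectors, and later blocks are only met by the diagonals of the `A m`. -/
theorem IsArrowSystem.exists_isDiagonalSystem {x : ℕ → H} {A : ℕ → H →L[ℂ] H}
    (h : IsArrowSystem x A) {V : Submodule ℂ (H →L[ℂ] H)} (hA : ∀ m, A m ∈ V) :
    ∃ (y : ℕ → H) (B : ℕ → H →L[ℂ] H), IsDiagonalSystem y B ∧ ∀ n, B n ∈ V := by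
  choose g hg y hy B hB hcross hnorm hdiag using h.exists_block
  let M : ℕ → ℕ := fun n => g^[n] 0
  have hM : ∀ n, M (n + 1) = g (M n) := fun n => Function.iterate_succ_apply' _ _ _
  have hmono : StrictMono M := strictMono_nat_of_lt_succ fun n => by rw [hM]; exact hg _
  have hM' : ∀ {i j}, i < j → g (M i) ≤ M j := fun hij => by
    rw [← hM]; exact hmono.monotone hij
  have hylt : ∀ {p n}, p < n → y (M p) ∈ Submodule.span ℂ (x '' Set.Iio (M n)) := fun hp =>
    Submodule.span_mono (Set.image_mono fun i hi => lt_of_lt_of_le hi.2 (hM' hp)) (hy _)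
  have hBlt : ∀ n, B (M n) ∈ Submodule.span ℂ (A '' Set.Ico (M n) (g (M n))) := fun n => hB _
  have hcross1 : ∀ n, ∀ z ∈ Submodule.span ℂ (x '' Set.Iio (M n)),
      ⟪z, B (M n) (y (M n))⟫_ℂ = 0 ∧ ⟪y (M n), B (M n) z⟫_ℂ = 0 := by
    intro n z hz
    induction hz using Submodule.span_induction with
    | zero => simp
    | add _ _ _ _ h1 h2 =>
      simp only [inner_add_left, map_add, inner_add_right, h1, h2, add_zero, and_self]
    | smul _ _ _ h1 =>
      simp only [inner_smul_left, map_smul, inner_smul_right, h1, mul_zero, and_self]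
    | mem z hz =>
      obtain ⟨i, hi, rfl⟩ := hz
      exact hcross (M n) i hi
  have horth : ∀ i j, i < j → ⟪y (M i), y (M j)⟫_ℂ = 0 := by
    intro i j hij
    have := inner_apply_eq_zero_of_mem_span (x := x) (A := fun _ => (1 : H →L[ℂ] H))
      (S := Set.Ico (M i) (g (M i))) (T := Set.univ) (U := Set.Ico (M j) (g (M j)))
      (B := 1) (y := y (M i)) (z := y (M j)) ?_ (hy _)
      (Submodule.subset_span ⟨0, trivial, rfl⟩) (hy _)
    · exact this
    · intro p hp _ _ q hq
      exact h.orthonormal.2 (ne_of_lt (hp.2.trans_le ((hM' hij).trans hq.1)))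
  refine ⟨fun n => y (M n), fun n => B (M n), ⟨⟨fun n => hnorm _, ?_⟩, ?_, ?_, fun n => hdiag _⟩,
    fun n => ?_⟩
  · intro i j hij
    rcases hij.lt_or_gt with h' | h'
    · exact horth i j h'
    · rw [← inner_conj_symm, horth j i h', map_zero]
  · intro n i j hij
    rcases lt_trichotomy (max i j) n with hn | hn | hn
    · exact inner_apply_eq_zero_of_mem_span
        (fun p hp k hk q hq => h.inner_eq_zero_of_lt (lt_of_lt_of_le hp hk.1)
          (lt_of_lt_of_le hq hk.1))
        (hylt (by omega : i < n)) (hBlt n) (hylt (by omega : j < n))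
    · rcases hij.lt_or_gt with h' | h'
      · obtain rfl : j = n := by omega
        exact (hcross1 j _ (hylt h')).1
      · obtain rfl : i = n := by omega
        exact (hcross1 i _ (hylt h')).2
    · refine inner_apply_eq_zero_of_mem_span (fun p hp k hk q hq => ?_) (hy _) (hBlt n) (hy _)
      rcases hij.lt_or_gt with h' | h'
      · have := hM' h'
        have := hM' (show n < j by omega)
        have := hp.2; have := hq.1; have := hk.2
        exact h.offDiag _ _ _ (by omega) (by omega)
      · have := hM' h'
        have := hM' (show n < i by omega)
        have := hp.1; have := hq.2; have := hk.2
        exact h.offDiag _ _ _ (by omega) (by omega)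
  · intro n i hi
    exact inner_apply_eq_zero_of_mem_span
      (fun p hp k hk q hq => h.inner_eq_zero_of_lt (lt_of_lt_of_le hp hk.1)
        (lt_of_lt_of_le hq hk.1)) (hylt hi) (hBlt n) (hylt hi)
  · exact (Submodule.span_le.2 (by rintro _ ⟨k, _, rfl⟩; exact hA k)) (hBlt n)

/-! ### Diagonal systems that are close to the diagonal matrix units -/

theorem norm_inner_apply_le {y : H} (hy : ‖y‖ = 1) (T : H →L[ℂ] H) : ‖⟪y, T y⟫_ℂ‖ ≤ ‖T‖ := by
  calc ‖⟪y, T y⟫_ℂ‖ ≤ ‖y‖ * ‖T y‖ := norm_inner_le_norm _ _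
    _ ≤ ‖y‖ * (‖T‖ * ‖y‖) := by gcongr; exact T.le_opNorm y
    _ = ‖T‖ := by rw [hy]; ring

theorem exists_subseq_tendsto_inner {ι : Type*} [Countable ι] {y : ℕ → H} (hy : ∀ n, ‖y n‖ = 1)
    (T : ι → H →L[ℂ] H) :
    ∃ (φ : ℕ → ℕ) (c : ι → ℂ), StrictMono φ ∧
      ∀ i, Tendsto (fun m => ⟪y (φ m), T i (y (φ m))⟫_ℂ) atTop (𝓝 (c i)) := by
  have hcomp : IsCompact (Set.univ.pi fun i => Metric.closedBall (0 : ℂ) ‖T i‖) :=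
    isCompact_univ_pi fun i => isCompact_closedBall _ _
  obtain ⟨c, -, φ, hφ, hlim⟩ := hcomp.tendsto_subseq (x := fun m i => ⟪y m, T i (y m)⟫_ℂ)
    fun m i _ => by simpa using norm_inner_apply_le (hy m) (T i)
  exact ⟨φ, c, hφ, fun i => tendsto_pi_nhds.1 hlim i⟩

theorem IsDiagonalSystem.comp {y : ℕ → H} {B : ℕ → H →L[ℂ] H} (h : IsDiagonalSystem y B)
    {φ : ℕ → ℕ} (hφ : StrictMono φ) : IsDiagonalSystem (y ∘ φ) (B ∘ φ) where
  orthonormal := h.orthonormal.comp φ hφ.injective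
  offDiag n _ _ hij := h.offDiag (φ n) _ _ (hφ.injective.ne hij)
  diag_lt n _ hi := h.diag_lt (φ n) _ (hφ hi)
  diag_self n := h.diag_self (φ n)

/-- Of two operators whose diagonals have limits, some nonzero combination has a diagonal tending to
zero. The pairs `B (2 * n)`, `B (2 * n + 1)` are replaced by such combinations, and one vector of
each pair is kept. -/
theorem IsDiagonalSystem.exists_tendsto_zero_of_tendsto {y : ℕ → H} {B : ℕ → H →L[ℂ] H}
    (h : IsDiagonalSystem y B) {V : Submodule ℂ (H →L[ℂ] H)} (hB : ∀ n, B n ∈ V) {c : ℕ → ℂ}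
    (hc : ∀ n, Tendsto (fun m => ⟪y m, B n (y m)⟫_ℂ) atTop (𝓝 (c n))) :
    ∃ (z : ℕ → H) (C : ℕ → H →L[ℂ] H), IsDiagonalSystem z C ∧ (∀ n, C n ∈ V) ∧
      ∀ n, Tendsto (fun m => ⟪z m, C n (z m)⟫_ℂ) atTop (𝓝 0) := by
  have hpair : ∀ n, ∃ (s : ℕ) (C : H →L[ℂ] H), (2 * n ≤ s ∧ s ≤ 2 * n + 1) ∧ C ∈ V ∧
      (∀ i j, i ≠ j → ⟪y i, C (y j)⟫_ℂ = 0) ∧ (∀ i < 2 * n, ⟪y i, C (y i)⟫_ℂ = 0) ∧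
      ⟪y s, C (y s)⟫_ℂ = 1 ∧ Tendsto (fun m => ⟪y m, C (y m)⟫_ℂ) atTop (𝓝 0) := by
    intro n
    by_cases h1 : c (2 * n + 1) = 0
    · exact ⟨2 * n + 1, B (2 * n + 1), by omega, hB _, h.offDiag _,
        fun i hi => h.diag_lt _ i (by omega), h.diag_self _, h1 ▸ hc _⟩
    · refine ⟨2 * n, B (2 * n) - (c (2 * n) / c (2 * n + 1)) • B (2 * n + 1), by omega,
        V.sub_mem (hB _) (V.smul_mem _ (hB _)), fun i j hij => ?_, fun i hi => ?_, ?_, ?_⟩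
      · simp [h.offDiag _ i j hij]
      · simp [h.diag_lt _ i hi,
          h.diag_lt (2 * n + 1) i (by omega)]
      · simp [h.diag_self,
          h.diag_lt (2 * n + 1) (2 * n) (by omega)]
      · simp only [sub_apply, smul_apply, inner_sub_right, inner_smul_right]
        have := (hc (2 * n)).sub ((hc (2 * n + 1)).const_mul (c (2 * n) / c (2 * n + 1)))
        rwa [div_mul_cancel₀ _ h1, sub_self] at this
  choose s C hs hCV hoff hlt hself hlim using hpair
  have hmono : StrictMono s := strictMono_nat_of_lt_succ fun n => by
    have := hs n; have := hs (n + 1); omega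
  refine ⟨y ∘ s, C, ⟨h.orthonormal.comp s hmono.injective,
    fun n i j hij => hoff n _ _ (hmono.injective.ne hij), fun n i hi => hlt n _ ?_, hself⟩, hCV,
    fun n => (hlim n).comp hmono.tendsto_atTop⟩
  have := hs i; omega

theorem IsDiagonalSystem.exists_small_of_tendsto_zero {y : ℕ → H} {B : ℕ → H →L[ℂ] H}
    (h : IsDiagonalSystem y B)
    (hlim : ∀ n, Tendsto (fun m => ⟪y m, B n (y m)⟫_ℂ) atTop (𝓝 0)) {ε : ℕ → ℝ}
    (hε : ∀ n, 0 < ε n) (hanti : Antitone ε) :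
    ∃ φ : ℕ → ℕ, StrictMono φ ∧
      ∀ n m, m ≠ n → ‖⟪y (φ m), B (φ n) (y (φ m))⟫_ℂ‖ ≤ ε n := by
  obtain ⟨φ, -, hφ⟩ := exists_seq_of_forall_finset_exists (fun _ : ℕ => True)
    (fun n m => n < m ∧ ‖⟪y m, B n (y m)⟫_ℂ‖ ≤ ε n) fun s _ => by
      have hev : ∀ᶠ m in atTop, ∀ n ∈ s, n < m ∧ ‖⟪y m, B n (y m)⟫_ℂ‖ ≤ ε n := by
        rw [Filter.eventually_all_finset]
        intro n _
        refine (eventually_gt_atTop n).and ?_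
        exact ((tendsto_zero_iff_norm_tendsto_zero.1 (hlim n)).eventually_le_const (hε n))
      obtain ⟨m, hm⟩ := hev.exists
      exact ⟨m, trivial, hm⟩
  have hmono : StrictMono φ := fun m n hmn => (hφ m n hmn).1
  refine ⟨φ, hmono, fun n m hmn => ?_⟩
  rcases hmn.lt_or_gt with h' | h'
  · rw [h.diag_lt _ _ (hmono h'), norm_zero]
    exact (hε n).le
  · exact (hφ n m h').2.trans (hanti hmono.le_apply)

/-- On the closed span of `x`, the operators `A k` approximate the diagonal matrix units, with
errors prescribed in advance. -/
theorem IsDiagonalSystem.exists_approx_matrixUnit {y : ℕ → H} {B : ℕ → H →L[ℂ] H}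
    (h : IsDiagonalSystem y B) {V : Submodule ℂ (H →L[ℂ] H)} (hB : ∀ n, B n ∈ V) {ε : ℕ → ℝ}
    (hε : ∀ n, 0 < ε n) (hanti : Antitone ε) :
    ∃ (x : ℕ → H) (A : ℕ → H →L[ℂ] H), Orthonormal ℂ x ∧ (∀ k, A k ∈ V) ∧
      ∀ k, ∀ u ∈ (Submodule.span ℂ (Set.range x)).topologicalClosure,
        ∀ v ∈ (Submodule.span ℂ (Set.range x)).topologicalClosure,
          ‖⟪v, A k u⟫_ℂ - ⟪v, x k⟫_ℂ * ⟪x k, u⟫_ℂ‖ ≤ ε k * (‖v‖ * ‖u‖) := by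
  obtain ⟨φ, c, hφ, hc⟩ := exists_subseq_tendsto_inner h.orthonormal.1 B
  obtain ⟨z, C, hz, hC, hlim⟩ := (h.comp hφ).exists_tendsto_zero_of_tendsto
    (fun n => hB (φ n)) fun n => hc (φ n)
  obtain ⟨ψ, hψ, hsmall⟩ := hz.exists_small_of_tendsto_zero hlim hε hanti
  have hx := hz.comp hψ
  refine ⟨z ∘ ψ, C ∘ ψ, hx.orthonormal, fun k => hC (ψ k), fun k u hu v hv => ?_⟩
  have hinner := orthonormal_iff_ite.1 hx.orthonormal
  have := norm_inner_le_of_diagonal hx.orthonormal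
    ((C ∘ ψ) k - InnerProductSpace.rankOne ℂ ((z ∘ ψ) k) ((z ∘ ψ) k)) (hε k).le ?_ ?_ hu hv
  · simpa [inner_sub_right, inner_smul_right, mul_comm] using this
  · intro i j hij
    rw [sub_apply, inner_sub_right, hx.offDiag k i j hij, InnerProductSpace.rankOne_apply,
      inner_smul_right, hinner, hinner, zero_sub]
    by_cases hki : k = j
    · simp [← hki, show i ≠ k by omega]
    · simp [hki]
  · intro i
    rw [sub_apply, inner_sub_right, InnerProductSpace.rankOne_apply, inner_smul_right, hinner,
      hinner]
    by_cases hki : i = k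
    · subst hki
      have hself : ⟪z (ψ i), C (ψ i) (z (ψ i))⟫_ℂ = 1 := hx.diag_self i
      simpa [hself] using (hε i).le
    · simpa [hki] using hsmall k i hki

/-! ### Almost anticliques -/

theorem isCompactOperator_rankOne (x y : H) :
    IsCompactOperator (InnerProductSpace.rankOne ℂ x y) :=
  (isCompactOperator_of_locallyCompactSpace_dom (innerSL ℂ y)).clm_comp
    (ContinuousLinearMap.toSpanSingleton ℂ x)

theorem norm_starProjection_mul_mul_le {X : Submodule ℂ H} [X.HasOrthogonalProjection]
    {T : H →L[ℂ] H} {ε : ℝ} (hε : 0 ≤ ε)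
    (h : ∀ u ∈ X, ∀ v ∈ X, ‖⟪v, T u⟫_ℂ‖ ≤ ε * (‖v‖ * ‖u‖)) :
    ‖X.starProjection * T * X.starProjection‖ ≤ ε := by
  refine ContinuousLinearMap.opNorm_le_bound _ hε fun u => ?_
  set w := X.starProjection (T (X.starProjection u)) with hw
  change ‖w‖ ≤ ε * ‖u‖
  have hwX : w ∈ X := Submodule.starProjection_apply_mem _ _
  have h1 : ‖w‖ * ‖w‖ ≤ ‖w‖ * (ε * ‖u‖) := by
    calc ‖w‖ * ‖w‖ = ‖⟪w, w⟫_ℂ‖ := by simp [inner_self_eq_norm_sq_to_K, sq]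
      _ = ‖⟪w, T (X.starProjection u)⟫_ℂ‖ := by
        conv_lhs => rw [hw, Submodule.inner_starProjection_left_eq_right, ← hw,
          Submodule.starProjection_eq_self_iff.2 hwX, ← inner_conj_symm, RCLike.norm_conj]
      _ ≤ ε * (‖w‖ * ‖X.starProjection u‖) := h _ (Submodule.starProjection_apply_mem _ _) _ hwX
      _ ≤ ε * (‖w‖ * ‖u‖) := by gcongr; exact X.norm_starProjection_apply_le u
      _ = _ := by ring
  rcases (norm_nonneg w).eq_or_lt with h0 | h0
  · rw [← h0]; positivity
  · exact le_of_mul_le_mul_left h1 h0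

/-- A diagonal operator with null diagonal is the norm limit of its finite truncations. -/
theorem isCompactOperator_compression_of_diagonal [CompleteSpace H] {x : ℕ → H}
    (hx : Orthonormal ℂ x) {D : H →L[ℂ] H} (hoff : ∀ i j, i ≠ j → ⟪x i, D (x j)⟫_ℂ = 0)
    (hlim : Tendsto (fun m => ⟪x m, D (x m)⟫_ℂ) atTop (𝓝 0)) {X : Submodule ℂ H}
    [X.HasOrthogonalProjection] (hX : X = (Submodule.span ℂ (Set.range x)).topologicalClosure) :
    IsCompactOperator (X.starProjection * D * X.starProjection) := by
  have hxX : ∀ m, X.starProjection (x m) = x m := fun m =>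
    Submodule.starProjection_eq_self_iff.2
      (hX ▸ Submodule.le_topologicalClosure _ (Submodule.subset_span ⟨m, rfl⟩))
  let F : ℕ → H →L[ℂ] H := fun n => ∑ m ∈ Finset.range n,
    ⟪x m, D (x m)⟫_ℂ • InnerProductSpace.rankOne ℂ (x m) (x m)
  have hF : ∀ n, IsCompactOperator (F n) := fun n => by
    have hmem : F n ∈ compactOperator (RingHom.id ℂ) H H := Submodule.sum_mem _ fun m _ =>
      Submodule.smul_mem _ _ (isCompactOperator_rankOne _ _)
    exact hmem
  have hQF : ∀ n, X.starProjection * F n * X.starProjection = F n := fun n => by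
    ext u
    simp only [F, mul_apply_eq_comp, sum_apply, smul_apply,
      InnerProductSpace.rankOne_apply, map_sum, map_smul, hxX,
      ← Submodule.inner_starProjection_left_eq_right]
  have hinner := orthonormal_iff_ite.1 hx
  have hentry : ∀ n i j, ⟪x i, F n (x j)⟫_ℂ =
      if i = j ∧ i < n then ⟪x i, D (x i)⟫_ℂ else 0 := fun n i j => by
    simp only [F, sum_apply, smul_apply, InnerProductSpace.rankOne_apply, inner_sum,
      inner_smul_right, hinner]
    by_cases hij : i = j
    · subst hij
      by_cases hin : i < n
      · rw [Finset.sum_eq_single_of_mem i (Finset.mem_range.2 hin)]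
        · simp [hin]
        · intro b _ hb; simp [hb]
      · rw [Finset.sum_eq_zero]
        · simp [hin]
        · intro b hb
          have : i ≠ b := by rintro rfl; exact hin (Finset.mem_range.1 hb)
          simp [this]
    · rw [Finset.sum_eq_zero]
      · simp [hij]
      · intro b hb
        by_cases hib : i = b
        · subst hib; simp [hij]
        · simp [hib]
  refine isCompactOperator_of_tendsto (F := F) (l := atTop) ?_ (Eventually.of_forall hF)
  rw [Metric.tendsto_atTop']
  intro ε hε
  obtain ⟨N, hN⟩ := Metric.tendsto_atTop.1 hlim (ε / 2) (by positivity)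
  refine ⟨N, fun n hn => ?_⟩
  rw [dist_comm, dist_eq_norm, ← hQF n, ← sub_mul, ← mul_sub]
  refine (norm_starProjection_mul_mul_le (ε := ε / 2) (by positivity) ?_).trans_lt (by linarith)
  intro u hu v hv
  subst hX
  refine norm_inner_le_of_diagonal hx _ (by positivity) (fun i j hij => ?_) (fun i => ?_) hu hv
  · rw [sub_apply, inner_sub_right, hoff i j hij, hentry]
    simp [hij]
  · rw [sub_apply, inner_sub_right, hentry]
    by_cases hin : i < n
    · simp [hin]; positivity
    · have := hN i (by omega)
      rw [dist_zero_right] at this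
      simpa [hin] using this.le

theorem exists_unit_mem_orthogonal {M G : Submodule ℂ H} [FiniteDimensional ℂ G]
    (hM : ¬ FiniteDimensional ℂ M) : ∃ y ∈ M, ‖y‖ = 1 ∧ y ∈ Gᗮ := by
  have : ∃ y ∈ M, y ≠ 0 ∧ y ∈ Gᗮ := by
    by_contra! hcon
    apply hM
    refine FiniteDimensional.of_injective
      ((G.orthogonalProjectionOnto : H →ₗ[ℂ] G) ∘ₗ M.subtype) ?_
    rw [← LinearMap.ker_eq_bot, LinearMap.ker_eq_bot']
    intro y hy
    by_contra hy0
    exact hcon y y.2 (by simpa using hy0) (Submodule.orthogonalProjectionOnto_eq_zero_iff.1 hy)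
  obtain ⟨y, hy, hy0, hyG⟩ := this
  have : ‖y‖ ≠ 0 := by simpa using hy0
  exact ⟨((‖y‖⁻¹ : ℝ) : ℂ) • y, M.smul_mem _ hy, by simp [norm_smul, this],
    Gᗮ.smul_mem _ hyG⟩

section

variable [CompleteSpace H]

/-- A finite-dimensional self-adjoint space of operators is simultaneously diagonal on some
orthonormal sequence in any given infinite-dimensional subspace. -/
theorem exists_orthonormal_diagonalizing {M : Submodule ℂ H} (hM : ¬ FiniteDimensional ℂ M)
    (W : Submodule ℂ (H →L[ℂ] H)) [FiniteDimensional ℂ W]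
    (hW : ∀ T ∈ W, ContinuousLinearMap.adjoint T ∈ W) :
    ∃ y : ℕ → H, Orthonormal ℂ y ∧ (∀ n, y n ∈ M) ∧
      ∀ T ∈ W, ∀ i j, i ≠ j → ⟪y i, T (y j)⟫_ℂ = 0 := by
  classical
  obtain ⟨y, hy, hr⟩ := exists_seq_of_forall_finset_exists (fun y : H => y ∈ M ∧ ‖y‖ = 1)
    (fun x y => ⟪x, y⟫_ℂ = 0 ∧ ∀ T ∈ W, ⟪T x, y⟫_ℂ = 0) fun s _ => by
      let G : Submodule ℂ H := s.sup fun x => Submodule.span ℂ {x} ⊔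
        W.map (ContinuousLinearMap.apply ℂ H x).toLinearMap
      have : FiniteDimensional ℂ G := Submodule.finiteDimensional_finset_sup _ _
      obtain ⟨y, hyM, hy1, hyG⟩ := exists_unit_mem_orthogonal (G := G) hM
      have hle : ∀ x ∈ s, Submodule.span ℂ {x} ⊔
          W.map (ContinuousLinearMap.apply ℂ H x).toLinearMap ≤ G := fun x hx =>
        Finset.le_sup (f := fun x => Submodule.span ℂ {x} ⊔
          W.map (ContinuousLinearMap.apply ℂ H x).toLinearMap) hx
      rw [Submodule.mem_orthogonal] at hyG
      exact ⟨y, ⟨hyM, hy1⟩, fun x hx =>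
        ⟨hyG _ (hle x hx (Submodule.mem_sup_left (Submodule.mem_span_singleton_self x))),
          fun T hT => hyG _ (hle x hx (Submodule.mem_sup_right ⟨T, hT, rfl⟩))⟩⟩
  refine ⟨y, ⟨fun n => (hy n).2, fun i j hij => ?_⟩, fun n => (hy n).1, fun T hT i j hij => ?_⟩
  · rcases hij.lt_or_gt with h | h
    · exact (hr i j h).1
    · rw [← inner_conj_symm, (hr j i h).1, map_zero]
  · rcases hij.lt_or_gt with h | h
    · rw [← ContinuousLinearMap.adjoint_inner_left]
      exact (hr i j h).2 _ (hW T hT)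
    · rw [← inner_conj_symm, (hr j i h).2 T hT, map_zero]

theorem adjoint_mem_compression {P : H →L[ℂ] H} (hP : IsSelfAdjoint P)
    {V : Submodule ℂ (H →L[ℂ] H)} (hV : IsOperatorSystem V) {T : H →L[ℂ] H}
    (hT : T ∈ compression P V) : ContinuousLinearMap.adjoint T ∈ compression P V := by
  rw [mem_compression] at hT ⊢
  obtain ⟨A, hA, rfl⟩ := hT
  refine ⟨_, hV.adjoint_mem A hA, ?_⟩
  simp only [← ContinuousLinearMap.star_eq_adjoint, star_mul, hP.star_eq, mul_assoc]

theorem exists_isInfiniteQuantumAlmostAnticlique {V : Submodule ℂ (H →L[ℂ] H)}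
    (hV : IsOperatorSystem V) {P : H →L[ℂ] H} (hP : IsInfiniteRankProjection P)
    (hfin : FiniteDimensional ℂ (compression P V)) :
    ∃ Q : H →L[ℂ] H, IsInfiniteQuantumAlmostAnticlique V Q := by
  obtain ⟨y, hy, hyM, hoff⟩ := exists_orthonormal_diagonalizing hP.infinite_rank
    (compression P V) fun T hT => adjoint_mem_compression hP.isStarProjection.isSelfAdjoint hV hT
  let b := Module.finBasis ℂ (compression P V)
  obtain ⟨φ, c, hφ, hc⟩ := exists_subseq_tendsto_inner hy.1 fun i => (b i : H →L[ℂ] H)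
  have hx : Orthonormal ℂ (y ∘ φ) := hy.comp φ hφ.injective
  set X := (Submodule.span ℂ (Set.range (y ∘ φ))).topologicalClosure with hX
  have hXcomplete : CompleteSpace X :=
    (Submodule.isClosed_topologicalClosure _).completeSpace_coe
  set Q := X.starProjection
  have hlim : ∀ T ∈ compression P V,
      ∃ l, Tendsto (fun m => ⟪y (φ m), T (y (φ m))⟫_ℂ) atTop (𝓝 l) := by
    intro T hT
    have hsum : T = ∑ i, b.repr ⟨T, hT⟩ i • (b i : H →L[ℂ] H) := by
      calc T = ((∑ i, b.repr ⟨T, hT⟩ i • b i : compression P V) : H →L[ℂ] H) := by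
            rw [b.sum_repr]
        _ = _ := by rw [AddSubmonoidClass.coe_finsetSum]; rfl
    refine ⟨∑ i, b.repr ⟨T, hT⟩ i * c i, ?_⟩
    have heq : ∀ m, ⟪y (φ m), T (y (φ m))⟫_ℂ =
        ∑ i, b.repr ⟨T, hT⟩ i * ⟪y (φ m), (b i : H →L[ℂ] H) (y (φ m))⟫_ℂ := fun m => by
      conv_lhs => rw [hsum]
      simp only [sum_apply, smul_apply, inner_sum, inner_smul_right]
    simp only [heq]
    exact tendsto_finsetSum _ fun i _ => (hc i).const_mul _
  have hPX : ∀ u ∈ X, P u = u := by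
    intro u hu
    refine (Submodule.topologicalClosure_minimal _ (t := LinearMap.eqLocus (P : H →ₗ[ℂ] H) LinearMap.id) ?_
      (isClosed_eq P.continuous continuous_id)) hu
    rw [Submodule.span_le]
    rintro _ ⟨m, rfl⟩
    obtain ⟨z, hz⟩ := hyM (φ m)
    change P (y (φ m)) = y (φ m)
    rw [← hz]
    exact congr_arg (fun T : H →L[ℂ] H => T z) hP.isStarProjection.isIdempotentElem
  have hPQ : P * Q = Q := by
    ext u
    exact hPX _ (X.starProjection_apply_mem u)
  have hQsa : star Q = Q := (isStarProjection_starProjection (U := X)).isSelfAdjoint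
  have hQP : Q * P = Q := by
    have := congr_arg star hPQ
    rwa [star_mul, hQsa, hP.isStarProjection.isSelfAdjoint.star_eq] at this
  have hQV : ∀ B ∈ compression Q V, ∃ T ∈ compression P V, Q * T * Q = B := by
    intro B hB
    obtain ⟨A, hA, rfl⟩ := (mem_compression _ _ _).1 hB
    refine ⟨P * A * P, (mem_compression _ _ _).2 ⟨A, hA, rfl⟩, ?_⟩
    calc Q * (P * A * P) * Q = (Q * P) * A * (P * Q) := by simp only [mul_assoc]
      _ = _ := by rw [hPQ, hQP]
  refine ⟨Q, isInfiniteRankProjection_starProjection fun h => ?_, ?_, fun B hB => ?_⟩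
  · have hli : LinearIndependent ℂ fun m => (⟨(y ∘ φ) m,
        Submodule.le_topologicalClosure _ (Submodule.subset_span ⟨m, rfl⟩)⟩ : X) :=
      LinearIndependent.of_comp X.subtype hx.linearIndependent
    have := hli.finite
    exact not_finite ℕ
  · have : FiniteDimensional ℂ (compression Q (compression P V)) :=
      Module.Finite.map (compression P V) (LinearMap.mulLeftRight ℂ (Q, Q))
    exact Submodule.finiteDimensional_of_le (S₂ := compression Q (compression P V))
      (fun B hB => (mem_compression _ _ _).2 (hQV B hB))
  · obtain ⟨T, hT, rfl⟩ := hQV B hB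
    obtain ⟨l, hl⟩ := hlim T hT
    refine ⟨l, Q * (T - l • 1) * Q, ?_, ?_⟩
    · refine isCompactOperator_compression_of_diagonal hx (fun i j hij => ?_) ?_ hX
      · have := hoff T hT _ _ (hφ.injective.ne hij)
        have h2 := hx.2 hij
        simp only [Function.comp_apply] at h2 ⊢
        simp [this, h2]
      · have := hl.sub_const l
        rw [sub_self] at this
        refine this.congr fun m => ?_
        simp [hy.1]
    · have : Q * Q = Q := (isStarProjection_starProjection (U := X)).isIdempotentElem
      rw [mul_sub, sub_mul, mul_smul_comm, smul_mul_assoc, mul_one, this]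
      abel

end

/-! ### Density for the weak operator topology -/

/-- An operator `T` is in the closure of a subspace of `B(H)` for the weak operator topology if each
finite-rank functional vanishing on the subspace vanishes at `T`. -/
theorem mem_closure_ofCLM_image [CompleteSpace H] {W : Submodule ℂ (H →L[ℂ] H)} {T : H →L[ℂ] H}
    (h : ∀ (n : ℕ) (u v : Fin n → H), (∀ A ∈ W, ∑ i, ⟪v i, A (u i)⟫_ℂ = 0) →
      ∑ i, ⟪v i, T (u i)⟫_ℂ = 0) :
    (ContinuousLinearMapWOT.ofCLM T : H →WOT[ℂ] H) ∈
      closure (ContinuousLinearMapWOT.ofCLM '' (W : Set (H →L[ℂ] H))) := by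
  classical
  rw [ContinuousLinearMapWOT.isInducing_inducingFn.closure_eq_preimage_closure_image,
    Set.mem_preimage, mem_closure_iff]
  intro o ho hTo
  obtain ⟨I, U, hU, hIo⟩ := isOpen_pi_iff.1 ho _ hTo
  let ev : (H →L[ℂ] H) →ₗ[ℂ] (I → ℂ) := LinearMap.pi fun p =>
    p.1.2.toLinearMap ∘ₗ (ContinuousLinearMap.apply ℂ H p.1.1).toLinearMap
  -- Finitely many matrix coefficients of `T` are attained exactly on `W`, because a subspace of a
  -- finite-dimensional space is the common kernel of the functionals vanishing on it.
  have hmem : ev T ∈ W.map ev := by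
    by_contra hcon
    obtain ⟨f, hf, hfW⟩ := Submodule.exists_le_ker_of_notMem hcon
    let e := I.equivFin
    let u : I → H := fun p => f (Pi.single p 1) • p.1.1
    let v : I → H := fun p => (InnerProductSpace.toDual ℂ H).symm p.1.2
    have hsum : ∀ A : H →L[ℂ] H, ∑ i, ⟪v (e.symm i), A (u (e.symm i))⟫_ℂ = f (ev A) := by
      intro A
      rw [Equiv.sum_comp e.symm fun p => ⟪v p, A (u p)⟫_ℂ, LinearMap.pi_apply_eq_sum_univ f (ev A)]
      refine Finset.sum_congr rfl fun p _ => ?_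
      simp only [u, v, map_smul, inner_smul_right, InnerProductSpace.toDual_symm_apply]
      rw [smul_eq_mul, mul_comm]
      congr 2
      ext q
      simp [Pi.single_apply, eq_comm]
    apply hf
    rw [← hsum]
    refine h _ _ _ fun A hA => ?_
    rw [hsum]
    exact hfW (Submodule.mem_map_of_mem hA)
  obtain ⟨A, hA, hAT⟩ := hmem
  refine ⟨_, hIo ?_, Set.mem_image_of_mem _ (Set.mem_image_of_mem _ hA)⟩
  intro p hp
  have : p.2 (A p.1) = p.2 (T p.1) := congr_fun hAT ⟨p, hp⟩
  change p.2 (A p.1) ∈ U p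
  rw [this]
  exact (hU p hp).2

/-- This is the statement that the trace of `C * ∑ i, |a i⟩⟨b i|` depends only on the operator
`∑ i, |a i⟩⟨b i|`, which is computed in an orthonormal basis of the span of the `b i`. -/
theorem sum_inner_apply_eq_zero_of_sum_rankOne_eq_zero {n : ℕ} {a b : Fin n → H}
    (h : ∑ i, InnerProductSpace.rankOne ℂ (a i) (b i) = 0) (C : H →L[ℂ] H) :
    ∑ i, ⟪b i, C (a i)⟫_ℂ = 0 := by
  let G := Submodule.span ℂ (Set.range b)
  have : FiniteDimensional ℂ G := FiniteDimensional.span_of_finite ℂ (Set.finite_range b)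
  let e := stdOrthonormalBasis ℂ G
  have hb : ∀ i, b i = ∑ r, ⟪(e r : H), b i⟫_ℂ • (e r : H) := fun i => by
    have := congr_arg Subtype.val (e.sum_repr' ⟨b i, Submodule.subset_span ⟨i, rfl⟩⟩)
    rw [AddSubmonoidClass.coe_finsetSum] at this
    exact this.symm
  calc ∑ i, ⟪b i, C (a i)⟫_ℂ
      = ∑ i, ∑ r, ⟪(e r : H), C (InnerProductSpace.rankOne ℂ (a i) (b i) (e r))⟫_ℂ := by
        refine Finset.sum_congr rfl fun i _ => ?_
        conv_lhs => rw [hb i]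
        rw [sum_inner]
        refine Finset.sum_congr rfl fun r _ => ?_
        rw [inner_smul_left, inner_conj_symm, InnerProductSpace.rankOne_apply, map_smul,
          inner_smul_right]
    _ = ∑ r, ⟪(e r : H), C ((∑ i, InnerProductSpace.rankOne ℂ (a i) (b i)) (e r))⟫_ℂ := by
        rw [Finset.sum_comm]
        simp only [sum_apply, map_sum, inner_sum]
    _ = 0 := by simp [h]

/-- Polarization: a finite-rank functional on `B(K)` that vanishes at `|w⟩⟨w|` for all `w` is
zero. -/
theorem sum_inner_starProjection_eq_zero {K : Submodule ℂ H} [K.HasOrthogonalProjection] {n : ℕ}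
    {u v : Fin n → H} (h : ∀ w ∈ K, ∑ i, ⟪v i, w⟫_ℂ * ⟪w, u i⟫_ℂ = 0) (C : H →L[ℂ] H) :
    ∑ i, ⟪K.starProjection (v i), C (K.starProjection (u i))⟫_ℂ = 0 := by
  apply sum_inner_apply_eq_zero_of_sum_rankOne_eq_zero
  rw [← starProjection_mul_mul_eq_zero (M := K)
    (A := ∑ i, InnerProductSpace.rankOne ℂ (u i) (v i))]
  · ext x
    simp only [sum_apply, mul_apply_eq_comp, InnerProductSpace.rankOne_apply, map_sum, map_smul,
      Submodule.inner_starProjection_left_eq_right]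
  · intro x hx
    simpa [inner_sum, inner_smul_right] using h x hx

/-! ### Construction of the clique -/

/-- A bounded sequence in `K` that visits every direction of a dense set infinitely often, which
makes a quadratic form vanish on `K` as soon as it tends to zero along the sequence. -/
theorem exists_seq_testing_quadratic (K : Submodule ℂ H) [TopologicalSpace.SeparableSpace K] :
    ∃ w : ℕ → H, (∀ j, w j ∈ K) ∧ (∀ j, ‖w j‖ ≤ 1) ∧
      ∀ Φ : H → ℂ, Continuous Φ → (∀ (c : ℝ) u, Φ ((c : ℂ) • u) = (c : ℂ) ^ 2 * Φ u) →
        Tendsto (fun j => Φ (w j)) atTop (𝓝 0) → ∀ u ∈ K, Φ u = 0 := by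
  let d := TopologicalSpace.denseSeq K
  refine ⟨fun j => (((1 + ‖d j.unpair.1‖)⁻¹ : ℝ) : ℂ) • (d j.unpair.1 : H),
    fun j => K.smul_mem _ (d _).2, fun j => ?_, fun Φ hΦ hhom hlim u hu => ?_⟩
  · rw [norm_smul, Complex.norm_real, Real.norm_of_nonneg (by positivity), inv_mul_eq_div,
      div_le_one (by positivity), Submodule.coe_norm]
    linarith
  · have hd : ∀ n, Φ (d n) = 0 := by
      intro n
      have htends : Tendsto (fun m => Nat.pair n m) atTop atTop :=
        tendsto_atTop_mono (fun m => Nat.right_le_pair n m) tendsto_id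
      have h1 := hlim.comp htends
      simp only [Function.comp_def, Nat.unpair_pair, hhom] at h1
      have h2 := tendsto_nhds_unique h1 tendsto_const_nhds
      have h3 : (((1 + ‖d n‖)⁻¹ : ℝ) : ℂ) ^ 2 ≠ 0 := by
        apply pow_ne_zero
        exact_mod_cast (inv_ne_zero (by positivity : (1 + ‖d n‖) ≠ 0))
      exact (mul_eq_zero.1 h2.symm).resolve_left h3
    have hclosed : IsClosed {z : K | Φ z = 0} :=
      isClosed_eq (hΦ.comp continuous_subtype_val) continuous_const
    have := (TopologicalSpace.denseRange_denseSeq K).closure_eq ▸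
      closure_minimal (by rintro _ ⟨n, rfl⟩; exact hd n) hclosed
    exact this (Set.mem_univ (⟨u, hu⟩ : K))

section

variable [CompleteSpace H]

/-- The oblique projection with kernel `Kᗮ` onto the graph of `u ↦ ∑ 2⁻ʲ ⟪w j, u⟫ x (2 j + 1)`,
where `K` is the closed span of the `x (2 i)`. -/
theorem exists_oblique_projection {x : ℕ → H} (hx : Orthonormal ℂ x) {K : Submodule ℂ H}
    [K.HasOrthogonalProjection]
    (hK : K = (Submodule.span ℂ (Set.range fun i => x (2 * i))).topologicalClosure) {w : ℕ → H}
    (hwK : ∀ j, w j ∈ K) (hw : ∀ j, ‖w j‖ ≤ 1) :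
    ∃ S : H →L[ℂ] H, (∀ u, S (K.starProjection u) = S u) ∧
      (∀ u, K.starProjection (S u) = K.starProjection u) ∧
      (∀ j u, ⟪x (2 * j + 1), S u⟫_ℂ = (1 / 2) ^ j * ⟪w j, u⟫_ℂ) ∧
      ∀ u, S u ∈ (Submodule.span ℂ (Set.range x)).topologicalClosure := by
  let t : ℕ → H →L[ℂ] H := fun j =>
    ((1 / 2 : ℂ) ^ j) • InnerProductSpace.rankOne ℂ (x (2 * j + 1)) (w j)
  have ht : Summable t := by
    refine Summable.of_norm_bounded (g := fun j => (1 / 2 : ℝ) ^ j) summable_geometric_two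
      fun j => ?_
    rw [norm_smul, InnerProductSpace.norm_rankOne, hx.1, one_mul]
    simpa using hw j
  have htu : ∀ u, HasSum (fun j => ((1 / 2 : ℂ) ^ j * ⟪w j, u⟫_ℂ) • x (2 * j + 1))
      ((∑' j, t j) u) := fun u => by
    have := (ContinuousLinearMap.apply ℂ H u).hasSum ht.hasSum
    simpa [t, smul_smul] using this
  have hPw : ∀ j u, ⟪w j, K.starProjection u⟫_ℂ = ⟪w j, u⟫_ℂ := fun j u => by
    rw [← Submodule.inner_starProjection_left_eq_right,
      Submodule.starProjection_eq_self_iff.2 (hwK j)]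
  have hodd : ∀ j, x (2 * j + 1) ∈ Kᗮ := fun j => by
    rw [hK, Submodule.orthogonal_closure, Submodule.mem_orthogonal]
    intro z hz
    induction hz using Submodule.span_induction with
    | zero => simp
    | add _ _ _ _ h1 h2 => rw [inner_add_left, h1, h2, add_zero]
    | smul _ _ _ h1 => rw [inner_smul_left, h1, mul_zero]
    | mem z hz =>
      obtain ⟨i, rfl⟩ := hz
      exact hx.2 (by omega)
  refine ⟨K.starProjection + ∑' j, t j, fun u => ?_, fun u => ?_, fun j u => ?_, fun u => ?_⟩
  · have h1 := htu (K.starProjection u)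
    simp only [hPw] at h1
    rw [add_apply, add_apply, h1.unique (htu u),
      Submodule.starProjection_eq_self_iff.2 (K.starProjection_apply_mem u)]
  · have h1 := K.starProjection.hasSum (htu u)
    simp only [map_smul, (Submodule.starProjection_apply_eq_zero_iff _).2 (hodd _), smul_zero]
      at h1
    rw [add_apply, map_add, h1.unique hasSum_zero, add_zero,
      Submodule.starProjection_eq_self_iff.2 (K.starProjection_apply_mem u)]
  · have h1 := (innerSL ℂ (x (2 * j + 1))).hasSum (htu u)
    have h2 : HasSum (fun i => innerSL ℂ (x (2 * j + 1))
        (((1 / 2 : ℂ) ^ i * ⟪w i, u⟫_ℂ) • x (2 * i + 1))) ((1 / 2 : ℂ) ^ j * ⟪w j, u⟫_ℂ) := by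
      convert hasSum_ite_eq j ((1 / 2 : ℂ) ^ j * ⟪w j, u⟫_ℂ) using 2 with i
      rw [innerSL_apply_apply, inner_smul_right, orthonormal_iff_ite.1 hx]
      by_cases hij : i = j
      · simp [hij]
      · simp [hij, show j ≠ i from Ne.symm hij]
    rw [add_apply, inner_add_right, (Submodule.mem_orthogonal' _ _).1 (hodd j) _
      (K.starProjection_apply_mem u), zero_add]
    exact h1.unique h2
  · have hxX : ∀ i, x i ∈ (Submodule.span ℂ (Set.range x)).topologicalClosure := fun i =>
      Submodule.le_topologicalClosure _ (Submodule.subset_span ⟨i, rfl⟩)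
    refine Submodule.add_mem _ ?_ ?_
    · have h1 : K ≤ (Submodule.span ℂ (Set.range x)).topologicalClosure := by
        rw [hK]
        exact Submodule.topologicalClosure_mono
          (Submodule.span_mono (Set.range_comp_subset_range _ x))
      exact h1 (K.starProjection_apply_mem u)
    · exact (Submodule.isClosed_topologicalClosure _).mem_of_tendsto (htu u)
        (Eventually.of_forall fun s => Submodule.sum_mem _ fun j _ =>
          Submodule.smul_mem _ _ (hxX _))

/-- If `V` contains good approximations to the diagonal matrix units on the closed span of `x`, then
the projection onto the range of the oblique projection `S` is a clique. The error `8⁻ᵏ` at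
`k = 2 j + 1` beats the factor `4⁻ʲ` by which the compressed matrix units shrink. -/
theorem exists_isInfiniteQuantumClique_of_approx {V : Submodule ℂ (H →L[ℂ] H)} {x : ℕ → H}
    {A : ℕ → H →L[ℂ] H} (hx : Orthonormal ℂ x) (hA : ∀ k, A k ∈ V)
    (happrox : ∀ k, ∀ u ∈ (Submodule.span ℂ (Set.range x)).topologicalClosure,
      ∀ v ∈ (Submodule.span ℂ (Set.range x)).topologicalClosure,
        ‖⟪v, A k u⟫_ℂ - ⟪v, x k⟫_ℂ * ⟪x k, u⟫_ℂ‖ ≤ (1 / 8 : ℝ) ^ k * (‖v‖ * ‖u‖)) :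
    ∃ P : H →L[ℂ] H, IsInfiniteQuantumClique V P := by
  set K := (Submodule.span ℂ (Set.range fun i => x (2 * i))).topologicalClosure with hK
  have hKcomplete : CompleteSpace K :=
    (Submodule.isClosed_topologicalClosure _).completeSpace_coe
  have hKsep : TopologicalSpace.SeparableSpace K :=
    ((Set.countable_range fun i => x (2 * i)).isSeparable.span (R := ℂ)).closure.separableSpace
  obtain ⟨w, hwK, hw, htest⟩ := exists_seq_testing_quadratic K
  obtain ⟨S, hSK, hKS, hSodd, hSX⟩ := exists_oblique_projection hx hK hwK hw
  have hSS : ∀ u, S (S u) = S u := fun u => by rw [← hSK, hKS, hSK]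
  set R := LinearMap.range (S : H →ₗ[ℂ] H)
  have hR : ∀ u ∈ R, S u = u := by
    rintro _ ⟨z, rfl⟩
    exact hSS z
  have hRclosed : IsClosed (R : Set H) := by
    have : (R : Set H) = {u | S u = u} := Set.ext fun u => ⟨hR u, fun h => ⟨u, h⟩⟩
    rw [this]
    exact isClosed_eq S.continuous continuous_id
  have hRcomplete : CompleteSpace R := hRclosed.completeSpace_coe
  refine ⟨R.starProjection, isInfiniteRankProjection_starProjection fun hfin => ?_, ?_⟩
  · have hxK : ∀ i, x (2 * i) ∈ K := fun i =>
      Submodule.le_topologicalClosure _ (Submodule.subset_span ⟨i, rfl⟩)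
    have hli : LinearIndependent ℂ fun i => (⟨S (x (2 * i)), _, rfl⟩ : R) := by
      refine LinearIndependent.of_comp ((K.starProjection : H →ₗ[ℂ] H) ∘ₗ R.subtype) ?_
      have heq : ((K.starProjection : H →ₗ[ℂ] H) ∘ₗ R.subtype) ∘
          (fun i => (⟨S (x (2 * i)), _, rfl⟩ : R)) = x ∘ fun i => 2 * i := funext fun i =>
        (hKS _).trans (Submodule.starProjection_eq_self_iff.2 (hxK i))
      rw [heq]
      exact hx.linearIndependent.comp _ fun i j hij => by simpa using hij
    have := hli.finite
    exact not_finite ℕ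
  · rintro _ ⟨_, hB, rfl⟩
    obtain ⟨B, -, rfl⟩ := (mem_compression _ _ _).1 hB
    refine mem_closure_ofCLM_image fun n u₀ v₀ hV => ?_
    set u := fun i => R.starProjection (u₀ i)
    set v := fun i => R.starProjection (v₀ i)
    have huR : ∀ i, S (u i) = u i := fun i => hR _ (Submodule.starProjection_apply_mem _ _)
    have hvR : ∀ i, S (v i) = v i := fun i => hR _ (Submodule.starProjection_apply_mem _ _)
    have hcomp : ∀ C : H →L[ℂ] H,
        ∑ i, ⟪v₀ i, (R.starProjection * C * R.starProjection) (u₀ i)⟫_ℂ =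
          ∑ i, ⟪v i, C (u i)⟫_ℂ := fun C => Finset.sum_congr rfl fun i _ =>
      (Submodule.inner_starProjection_left_eq_right R (v₀ i) _).symm
    have hV' : ∀ C ∈ V, ∑ i, ⟪v i, C (u i)⟫_ℂ = 0 := fun C hC => by
      rw [← hcomp]
      exact hV _ ((mem_compression _ _ _).2 ⟨C, hC, rfl⟩)
    rw [hcomp]
    have hΦ : ∀ z ∈ K, ∑ i, ⟪v i, z⟫_ℂ * ⟪z, u i⟫_ℂ = 0 := by
      refine htest (fun z => ∑ i, ⟪v i, z⟫_ℂ * ⟪z, u i⟫_ℂ) (by fun_prop) (fun c z => ?_) ?_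
      · simp only [inner_smul_left, inner_smul_right, Complex.conj_ofReal, Finset.mul_sum]
        exact Finset.sum_congr rfl fun i _ => by ring
      · refine squeeze_zero_norm (a := fun j => (1 / 16 : ℝ) ^ j * ∑ i, ‖v i‖ * ‖u i‖)
          (fun j => ?_) ?_
        · -- The coordinates of `u i` and `v i` at `2 j + 1` carry a factor `2⁻ʲ` each.
          have h1 : (1 / 4 : ℂ) ^ j * ∑ i, ⟪v i, w j⟫_ℂ * ⟪w j, u i⟫_ℂ =
              -∑ i, (⟪v i, A (2 * j + 1) (u i)⟫_ℂ -
                ⟪v i, x (2 * j + 1)⟫_ℂ * ⟪x (2 * j + 1), u i⟫_ℂ) := by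
            rw [Finset.sum_sub_distrib, hV' _ (hA _), zero_sub, neg_neg, Finset.mul_sum]
            refine Finset.sum_congr rfl fun i _ => ?_
            rw [← inner_conj_symm (v i) (x _), ← huR i, ← hvR i, hSodd, hSodd, huR, hvR, map_mul,
              inner_conj_symm, show (1 / 4 : ℂ) = 1 / 2 * (1 / 2) by norm_num, mul_pow]
            simp only [map_pow, map_div₀, map_one, Complex.conj_ofNat]
            ring
          have h2 : (1 / 4 : ℝ) ^ j * ‖∑ i, ⟪v i, w j⟫_ℂ * ⟪w j, u i⟫_ℂ‖ ≤
              (1 / 8 : ℝ) ^ (2 * j + 1) * ∑ i, ‖v i‖ * ‖u i‖ := by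
            calc _ = ‖(1 / 4 : ℂ) ^ j * ∑ i, ⟪v i, w j⟫_ℂ * ⟪w j, u i⟫_ℂ‖ := by simp
              _ ≤ _ := by
                rw [h1, norm_neg, Finset.mul_sum]
                refine (norm_sum_le _ _).trans (Finset.sum_le_sum fun i _ => ?_)
                refine happrox _ _ ?_ _ ?_
                · rw [← huR]; exact hSX _
                · rw [← hvR]; exact hSX _
          have h3 : (1 / 8 : ℝ) ^ (2 * j + 1) ≤ (1 / 4) ^ j * (1 / 16) ^ j := by
            rw [pow_succ, pow_mul, ← mul_pow]
            norm_num
          have h4 : 0 ≤ ∑ i, ‖v i‖ * ‖u i‖ := by positivity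
          have h5 : (0 : ℝ) < (1 / 4) ^ j := by positivity
          refine le_of_mul_le_mul_left (h2.trans ?_) h5
          rw [← mul_assoc]
          gcongr
        · have := (tendsto_pow_atTop_nhds_zero_of_lt_one (r := (1 / 16 : ℝ)) (by norm_num)
            (by norm_num)).mul_const (∑ i, ‖v i‖ * ‖u i‖)
          rwa [zero_mul] at this
    have := sum_inner_starProjection_eq_zero hΦ (ContinuousLinearMap.adjoint S * B * S)
    rw [← this]
    refine Finset.sum_congr rfl fun i _ => ?_
    simp only [mul_apply_eq_comp, ContinuousLinearMap.adjoint_inner_right, hSK, huR, hvR]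

end

end

theorem corollary1p5 {H : Type*} [NormedAddCommGroup H] [InnerProductSpace ℂ H]
    [CompleteSpace H] (hH : ¬ FiniteDimensional ℂ H)
    (V : Submodule ℂ (H →L[ℂ] H)) (hV : IsOperatorSystem V) :
    (∃ P : H →L[ℂ] H, IsInfiniteQuantumClique V P) ∨
      (∃ P : H →L[ℂ] H, IsInfiniteQuantumAlmostAnticlique V P) := by
  by_cases h : ∃ P, IsInfiniteRankProjection P ∧ FiniteDimensional ℂ (compression P V)
  · obtain ⟨P, hP, hfin⟩ := h
    exact Or.inr (exists_isInfiniteQuantumAlmostAnticlique hV hP hfin)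
  · push Not at h
    obtain ⟨x, A, hsys, hA⟩ := exists_isArrowSystem hH h
    obtain ⟨y, B, hdiag, hB⟩ := hsys.exists_isDiagonalSystem hA
    obtain ⟨z, C, hz, hC, happrox⟩ := hdiag.exists_approx_matrixUnit hB
      (ε := fun k => (1 / 8 : ℝ) ^ k) (fun k => by positivity)
      (pow_right_anti₀ (by norm_num) (by norm_num))
    exact Or.inl (exists_isInfiniteQuantumClique_of_approx hz hC happrox)
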